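/- Let $k$ be an algebraic closure of a finite field, and let $U$ and $V$ be smooth affine connected schemes of finite type over $k$. Let $\eta\colon \operatorname{Spec}\Omega\to U\times_k V$ be a geometric point (with $\Omega$ a separably closed field), and let $\eta'$ and $\eta''$ be its images in $U$ and $V$ under the two projections $p_U\colon U\times_k V\to U$ and $p_V\colon U\times_k V\to V$. For a scheme $X$ with a geometric point $x$, let $\pi_1(X,x)$ denote the étale fundamental group, that is, the automorphism group of the fibre functor $Y\mapsto \operatorname{Hom}_X(x,Y)$ on the category of finite étale $X$-schemes. Then the natural homomorphism $$(p_{U,*},p_{V,*})\colon \pi_1(U\times_k V,\eta)\longrightarrow \pi_1(U,\eta')\times\pi_1(V,\eta'')$$ is surjective. -/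

import Mathlib

open CategoryTheory CategoryTheory.Limits AlgebraicGeometry

universe u

noncomputable section

namespace EtalePi

/-- The property of a morphism of schemes of being finite étale. -/
abbrev finiteEtale : MorphismProperty Scheme.{u} := @IsFinite ⊓ @Etale

instance : finiteEtale.{u}.IsStableUnderBaseChange :=
  MorphismProperty.IsStableUnderBaseChange.inf

/-- The category of finite étale schemes over `X` (finite étale coverings of `X`), with all
`X`-morphisms between them. -/
abbrev FEt (X : Scheme.{u}) : Type (u + 1) := finiteEtale.{u}.Over ⊤ X

/-- The geometric points of the `X`-scheme `p : Y ⟶ X` lying over `x : Spec Ω ⟶ X`. -/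
abbrev Fibre {X Y : Scheme.{u}} (p : Y ⟶ X) {Ω : Type u} [Field Ω]
    (x : Spec (.of Ω) ⟶ X) : Type u :=
  { y : Spec (.of Ω) ⟶ Y // y ≫ p = x }

/-- A finite morphism has finite geometric fibres. -/
instance finite_fibre {X Y : Scheme.{u}} (p : Y ⟶ X) [IsFinite p] {Ω : Type u} [Field Ω]
    (x : Spec (.of Ω) ⟶ X) : Finite (Fibre p x) := by
  let q := pullback.snd p x
  have hq : q.appTop.hom.Finite := q.finite_appTop
  have : IsAffine (pullback p x) := isAffine_of_isAffineHom q
  have hK : IsField Γ(Spec (.of Ω), ⊤) :=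
    (Scheme.ΓSpecIso (.of Ω)).commRingCatIsoToRingEquiv.toMulEquiv.isField (Field.toIsField Ω)
  let _ : Field Γ(Spec (.of Ω), ⊤) := hK.toField
  let _ : Algebra Γ(Spec (.of Ω), ⊤) Γ(pullback p x, ⊤) := q.appTop.hom.toAlgebra
  have : Module.Finite Γ(Spec (.of Ω), ⊤) Γ(pullback p x, ⊤) := hq
  let s (y : Fibre p x) : Spec (.of Ω) ⟶ pullback p x :=
    pullback.lift y.1 (𝟙 _) (y.2.trans (Category.id_comp x).symm)
  have hs (y : Fibre p x) : q.appTop ≫ (s y).appTop = 𝟙 _ := by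
    have h : s y ≫ q = 𝟙 _ := pullback.lift_snd _ _ _
    rw [← Scheme.Hom.comp_appTop, h, Scheme.Hom.id_appTop]
  let φ (y : Fibre p x) : Γ(pullback p x, ⊤) →ₐ[Γ(Spec (.of Ω), ⊤)] Γ(Spec (.of Ω), ⊤) :=
    { (s y).appTop.hom with
      commutes' := fun r ↦ congr($(hs y) r) }
  refine Finite.of_injective φ fun y z h ↦ ?_
  have h1 : (s y).appTop = (s z).appTop := by
    ext a
    exact DFunLike.congr_fun h a
  have h2 : s y = s z := ext_of_isAffine h1
  have hf (y : Fibre p x) : s y ≫ pullback.fst p x = y.1 := pullback.lift_fst _ _ _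
  exact Subtype.ext (by rw [← hf y, ← hf z, h2])

instance {X : Scheme.{u}} (Y : FEt X) : IsFinite Y.hom := Y.prop.1

instance {X : Scheme.{u}} (Y : FEt X) : Etale Y.hom := Y.prop.2

/-- The fibre functor at a geometric point `x : Spec Ω ⟶ X`: a finite étale `Y ⟶ X` is sent to
the finite set of geometric points of `Y` over `x`. -/
@[simps]
def fibre {X : Scheme.{u}} {Ω : Type u} [Field Ω] (x : Spec (.of Ω) ⟶ X) :
    FEt X ⥤ FintypeCat.{u} where
  obj Y := .of (Fibre Y.hom x)
  map f := FintypeCat.homMk fun y ↦ ⟨y.1 ≫ f.left, by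
    rw [Category.assoc]
    exact (congr(y.1 ≫ $(MorphismProperty.Over.w f))).trans y.2⟩

/-- The étale fundamental group `π₁(X, x)`: the automorphism group of the fibre functor. -/
abbrev Pi1 {X : Scheme.{u}} {Ω : Type u} [Field Ω] (x : Spec (.of Ω) ⟶ X) : Type (u + 1) :=
  Aut (fibre x)

/-- Pullback of finite étale coverings along `f`. -/
abbrev pullbackFEt {X' X : Scheme.{u}} (f : X' ⟶ X) : FEt X ⥤ FEt X' :=
  MorphismProperty.Over.pullback finiteEtale ⊤ f

/-- The geometric points of `Y ×_X X'` over `x'` are those of `Y` over the image `x' ≫ f`. -/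
@[simps]
def fibrePullbackEquiv {X' X Y : Scheme.{u}} (p : Y ⟶ X) (f : X' ⟶ X) {Ω : Type u} [Field Ω]
    (x' : Spec (.of Ω) ⟶ X') : Fibre (pullback.snd p f) x' ≃ Fibre p (x' ≫ f) where
  toFun y := ⟨y.1 ≫ pullback.fst p f, by
    rw [Category.assoc, pullback.condition, ← Category.assoc, y.2]⟩
  invFun y := ⟨pullback.lift y.1 x' y.2, pullback.lift_snd _ _ _⟩
  left_inv y := by
    apply Subtype.ext
    apply pullback.hom_ext
    · exact pullback.lift_fst _ _ _
    · exact (pullback.lift_snd _ _ _).trans y.2.symm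
  right_inv y := Subtype.ext (pullback.lift_fst _ _ _)

/-- The fibre functor at the image of `x'` under `f` is the pullback functor followed by the fibre
functor at `x'`. -/
def fibrePullbackIso {X' X : Scheme.{u}} (f : X' ⟶ X) {Ω : Type u} [Field Ω]
    (x' : Spec (.of Ω) ⟶ X') : pullbackFEt f ⋙ fibre x' ≅ fibre (x' ≫ f) :=
  NatIso.ofComponents
    (fun Y ↦ FintypeCat.equivEquivIso (fibrePullbackEquiv Y.hom f x'))
    (fun {Y Z} g ↦ by
      ext y
      apply Subtype.ext
      have h : ((pullbackFEt f).map g).left ≫ pullback.fst Z.hom f =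
          pullback.fst Y.hom f ≫ g.left := pullback.lift_fst _ _ _
      exact (Category.assoc _ _ _).trans
        ((congrArg (y.1 ≫ ·) h).trans (Category.assoc _ _ _).symm))

/-- The homomorphism `f_* : π₁(X', x') → π₁(X, f(x'))` induced by `f : X' ⟶ X`: an automorphism of
the fibre functor at `x'` acts on the fibre of `Y` at `f(x')`, which is the fibre at `x'` of the
pullback of `Y` along `f`. -/
def Pi1.map {X' X : Scheme.{u}} (f : X' ⟶ X) {Ω : Type u} [Field Ω]
    (x' : Spec (.of Ω) ⟶ X') : Pi1 x' →* Pi1 (x' ≫ f) :=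
  (fibrePullbackIso f x').conjAut.toMonoidHom.comp
    (((Functor.whiskeringLeft _ _ FintypeCat.{u}).obj (pullbackFEt f)).mapAut (fibre x'))

end EtalePi

end

-- Given `σ` and `τ`, one must find an automorphism acting as `σ` on coverings pulled back from `U`
-- and as `τ` on those from `V`. By compactness (`exists_aut_of_forall_finset`) it suffices to treat
-- finitely many coverings at a time. All points in the fibres of the coverings of `U` concerned are
-- images of one point `a` of a connected covering `A`; likewise `b` on `B` over `V`. As `k` is
-- algebraically closed, `A ×_k B` is connected, so any connected covering `P` mapping to it hits
-- both `(a, b)` and `(σ a, τ b)`. Moving a point of `P` above the first to a point above the second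
-- gives the required permutations (`exists_perm_of_dominates`, `exists_perm_natural`).

universe v w

/-! ### Connectedness, rigidity of morphisms, lifting of geometric points. -/

namespace AlgebraicGeometry

/-- A product of connected schemes locally of finite type over an algebraically closed field is
connected. -/
theorem connectedSpace_pullback_of_isAlgClosed {k : Type u} [Field k] [IsAlgClosed k]
    {X Y : Scheme.{u}} (f : X ⟶ Spec (.of k)) (g : Y ⟶ Spec (.of k)) [LocallyOfFiniteType f]
    [LocallyOfFiniteType g] [ConnectedSpace X] [ConnectedSpace Y] :
    ConnectedSpace ↥(pullback f g) := by
  let pt (a : Spec (.of k) ⟶ X) (b : Spec (.of k) ⟶ Y) (ha : a ≫ f = 𝟙 _) (hb : b ≫ g = 𝟙 _) :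
      ↥(pullback f g) := pullback.lift a b (ha.trans hb.symm) default
  -- Closed points are `k`-rational, hence pairs of rational points of the factors.
  have hpt (x : ↥(pullback f g)) (hx : IsClosed {x}) : ∃ a b ha hb, x = pt a b ha hb := by
    let p := pullback.fst f g ≫ f
    have hp := pointOfClosedPoint_comp p x hx
    have hp' : pointOfClosedPoint p x hx ≫ pullback.snd f g ≫ g = 𝟙 _ := by
      rw [← pullback.condition]; exact hp
    refine ⟨pointOfClosedPoint p x hx ≫ pullback.fst f g,
      pointOfClosedPoint p x hx ≫ pullback.snd f g, (Category.assoc _ _ _).trans hp,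
      (Category.assoc _ _ _).trans hp', ?_⟩
    have : pullback.lift (pointOfClosedPoint p x hx ≫ pullback.fst f g)
        (pointOfClosedPoint p x hx ≫ pullback.snd f g) (by simp [pullback.condition]) =
        pointOfClosedPoint p x hx := by
      apply pullback.hom_ext
      · exact pullback.lift_fst _ _ _
      · exact pullback.lift_snd _ _ _
    simp only [pt, this, pointOfClosedPoint_apply]
  -- The slice over `a` is the image of the connected `Y`, so it stays in one component; `hr` does
  -- the same for `X`.
  have hl (a b b' ha hb hb') : pt a b' ha hb' ∈ connectedComponent (pt a b ha hb) := by
    let i : Y ⟶ pullback f g := pullback.lift (g ≫ a) (𝟙 _) (by simp [ha])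
    have h (b hb) : pt a b ha hb = i (b default) := by
      have : pullback.lift a b (ha.trans hb.symm) = b ≫ i := by
        apply pullback.hom_ext
        · rw [pullback.lift_fst, Category.assoc, pullback.lift_fst, reassoc_of% hb]
        · rw [pullback.lift_snd, Category.assoc, pullback.lift_snd, Category.comp_id]
      rw [← Scheme.Hom.comp_apply, ← this]
    rw [h b hb, h b' hb']
    exact (isPreconnected_range i.continuous).subset_connectedComponent ⟨_, rfl⟩ ⟨_, rfl⟩
  have hr (a a' b ha ha' hb) : pt a' b ha' hb ∈ connectedComponent (pt a b ha hb) := by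
    let i : X ⟶ pullback f g := pullback.lift (𝟙 _) (f ≫ b) (by simp [hb])
    have h (a ha) : pt a b ha hb = i (a default) := by
      have : pullback.lift a b (ha.trans hb.symm) = a ≫ i := by
        apply pullback.hom_ext
        · rw [pullback.lift_fst, Category.assoc, pullback.lift_fst, Category.comp_id]
        · rw [pullback.lift_snd, Category.assoc, pullback.lift_snd, reassoc_of% ha]
      rw [← Scheme.Hom.comp_apply, ← this]
    rw [h a ha, h a' ha']
    exact (isPreconnected_range i.continuous).subset_connectedComponent ⟨_, rfl⟩ ⟨_, rfl⟩
  have : JacobsonSpace ↥(pullback f g) :=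
    LocallyOfFiniteType.jacobsonSpace (pullback.fst f g ≫ f)
  have : Nonempty ↥(pullback f g) := by
    have : Surjective f := inferInstance
    have : Surjective (pullback.snd f g) := inferInstance
    obtain ⟨y⟩ := (inferInstance : Nonempty Y)
    exact ⟨(this.surj y).choose⟩
  rw [connectedSpace_iff_connectedComponent]
  obtain ⟨x, -, hx⟩ : ((Set.univ : Set ↥(pullback f g)) ∩ closedPoints _).Nonempty :=
    nonempty_inter_closedPoints Set.univ_nonempty isOpen_univ.isLocallyClosed
  refine ⟨x, Set.univ_subset_iff.mp ?_⟩
  -- Closed points are dense in a Jacobson space, and two of them are joined by two slices.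
  rw [← closure_closedPoints]
  refine closure_minimal (fun y hy ↦ ?_) isClosed_connectedComponent
  obtain ⟨a, b, ha, hb, rfl⟩ := hpt x hx
  obtain ⟨a', b', ha', hb', rfl⟩ := hpt y hy
  exact connectedComponent_eq (hl a b b' ha hb hb') ▸ hr a a' b' ha ha' hb'

/-- Two `X`-morphisms from a connected scheme to an unramified separated `X`-scheme agree
if they agree at one geometric point. -/
theorem eq_of_comp_eq_of_connectedSpace {X P W T : Scheme.{u}} (q : W ⟶ X)
    [FormallyUnramified q] [LocallyOfFiniteType q] [IsSeparated q] [ConnectedSpace P] [Nonempty T]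
    (f g : P ⟶ W) (h : f ≫ q = g ≫ q) (t : T ⟶ P) (ht : t ≫ f = t ≫ g) : f = g := by
  let d : P ⟶ pullback q q := pullback.lift f g h
  -- `i` is the equaliser of `f` and `g`: closed since `q` is separated, open since `q` is
  -- unramified.
  let i := pullback.snd (pullback.diagonal q) d
  have : IsClosedImmersion i := inferInstance
  have : IsOpenImmersion i := inferInstance
  have hi : i ≫ f = i ≫ g := by
    have h1 : i ≫ d ≫ pullback.fst q q = i ≫ d ≫ pullback.snd q q := by
      simp only [i, ← pullback.condition_assoc, pullback.diagonal_fst, pullback.diagonal_snd]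
    rwa [pullback.lift_fst, pullback.lift_snd] at h1
  have hti : pullback.lift (t ≫ f) t (by
      apply pullback.hom_ext
      · rw [Category.assoc t d, Category.assoc, pullback.diagonal_fst, pullback.lift_fst]
        exact congrArg (t ≫ ·) (Category.comp_id f)
      · rw [Category.assoc t d, Category.assoc, pullback.diagonal_snd, pullback.lift_snd, ← ht]
        exact congrArg (t ≫ ·) (Category.comp_id f)) ≫ i = t :=
    pullback.lift_snd _ _ _
  have hs : Set.range i = Set.univ := by
    apply IsClopen.eq_univ ⟨i.isClosedEmbedding.isClosed_range, i.isOpenEmbedding.isOpen_range⟩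
    obtain ⟨x⟩ := (inferInstance : Nonempty T)
    refine ⟨t x, ?_⟩
    rw [← hti, Scheme.Hom.comp_apply]
    exact ⟨_, rfl⟩
  have : Surjective i := ⟨Set.range_eq_univ.mp hs⟩
  have : IsIso i := (isIso_iff_isOpenImmersion_and_surjective i).mpr ⟨inferInstance, inferInstance⟩
  rwa [cancel_epi] at hi

/-- The connected component of a point of a Noetherian space is clopen. -/
theorem isClopen_connectedComponent_of_noetherianSpace {X : Type*} [TopologicalSpace X]
    [TopologicalSpace.NoetherianSpace X] (x : X) : IsClopen (connectedComponent x) := by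
  refine ⟨isClosed_connectedComponent, ?_⟩
  -- The complement is a union of irreducible components, of which there are finitely many, so it is
  -- closed.
  have hU : (connectedComponent x)ᶜ =
      ⋃₀ {Z ∈ irreducibleComponents X | Z ⊆ (connectedComponent x)ᶜ} := by
    refine subset_antisymm (fun y hy ↦ ⟨irreducibleComponent y, ⟨⟨?_, ?_⟩, ?_⟩⟩)
      (Set.sUnion_subset fun Z hZ ↦ hZ.2)
    · exact irreducibleComponent_mem_irreducibleComponents y
    · intro z hz hzx
      have hzy : z ∈ connectedComponent y :=
        isIrreducible_irreducibleComponent.isConnected.isPreconnected.subset_connectedComponent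
          mem_irreducibleComponent hz
      apply hy
      rw [connectedComponent_eq hzx, ← connectedComponent_eq hzy]
      exact mem_connectedComponent
    · exact mem_irreducibleComponent
  rw [← isClosed_compl_iff, hU, Set.sUnion_eq_biUnion]
  exact Set.Finite.isClosed_biUnion
    (TopologicalSpace.NoetherianSpace.finite_irreducibleComponents.subset (Set.sep_subset _ _))
    fun Z hZ ↦ isClosed_of_mem_irreducibleComponents Z hZ.1

/-- A finite étale morphism from a nonempty scheme to a connected scheme is surjective. -/
theorem surjective_of_isFinite_of_etale {P Q : Scheme.{u}} (f : P ⟶ Q) [IsFinite f] [Etale f]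
    [Nonempty P] [ConnectedSpace Q] : Surjective f := by
  refine ⟨Set.range_eq_univ.mp (IsClopen.eq_univ ⟨?_, ?_⟩ (Set.range_nonempty f))⟩
  · exact f.isClosedMap.isClosed_range
  · exact f.isOpenMap.isOpen_range

/-- Geometric points lift along a finite étale morphism to a connected scheme. -/
theorem exists_fac_of_isFinite_of_etale {P Q : Scheme.{u}} (f : P ⟶ Q) [IsFinite f] [Etale f]
    [Nonempty P] [ConnectedSpace Q] {Ω : Type u} [Field Ω] [IsSepClosed Ω]
    (q : Spec (.of Ω) ⟶ Q) : ∃ p : Spec (.of Ω) ⟶ P, p ≫ f = q := by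
  obtain ⟨x, hx⟩ := (surjective_of_isFinite_of_etale f).surj (q default)
  obtain ⟨p, hp, -⟩ := Scheme.exists_fac_of_etale_of_isSepClosed f q x hx
  exact ⟨p, hp⟩

/-- A morphism from the spectrum of a field to a Noetherian scheme factors through a
connected clopen subscheme. -/
theorem exists_connectedSpace_fac {T : Scheme.{u}} [IsNoetherian T] {Ω : Type u} [Field Ω]
    (t : Spec (.of Ω) ⟶ T) :
    ∃ (P : Scheme.{u}) (i : P ⟶ T) (p : Spec (.of Ω) ⟶ P), IsClosedImmersion i ∧
      IsOpenImmersion i ∧ ConnectedSpace P ∧ p ≫ i = t := by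
  have hC := isClopen_connectedComponent_of_noetherianSpace (t default)
  let C : T.Opens := ⟨connectedComponent (t default), hC.2⟩
  have hr : Set.range C.ι = connectedComponent (t default) := Scheme.Opens.range_ι C
  refine ⟨C, C.ι, IsOpenImmersion.lift C.ι t ?_, ?_, inferInstance, ?_,
    IsOpenImmersion.lift_fac _ _ _⟩
  · rintro _ ⟨a, rfl⟩
    rw [hr, Subsingleton.elim a default]
    exact mem_connectedComponent
  · exact IsClosedImmersion.of_isPreimmersion _ (hr ▸ hC.1)
  · exact isConnected_iff_connectedSpace.mp isConnected_connectedComponent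

end AlgebraicGeometry

noncomputable section

namespace EtalePi

/-! ### Functors to finite sets: compactness and transport of a point. -/

section FibreFunctor

variable {C : Type v} [Category.{w} C] (F : C ⥤ FintypeCat.{u})

/-- Compactness: prescribed values of an automorphism of a functor to finite sets can be realised
if they can be realised by families of permutations that are natural on finite sets of objects. -/
theorem exists_aut_of_forall_finset {ι : Type*} (W : ι → C)
    (s : ∀ i, Equiv.Perm (F.obj (W i)))
    (H : ∀ (S : Finset C) (I : Finset ι), ∃ g : ∀ X, Equiv.Perm (F.obj X),
      (∀ X ∈ S, ∀ Y ∈ S, ∀ (f : X ⟶ Y) (x : F.obj X), F.map f (g X x) = g Y (F.map f x)) ∧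
      ∀ i ∈ I, g (W i) = s i) :
    ∃ α : Aut F, ∀ i (x : F.obj (W i)), α.hom.app (W i) x = s i x := by
  let (X : C) : TopologicalSpace (Equiv.Perm (F.obj X)) := ⊥
  have (X : C) : DiscreteTopology (Equiv.Perm (F.obj X)) := ⟨rfl⟩
  let Z (J : Finset C × Finset ι) : Set (∀ X, Equiv.Perm (F.obj X)) :=
    {g | (∀ X ∈ J.1, ∀ Y ∈ J.1, ∀ (f : X ⟶ Y) (x : F.obj X),
      F.map f (g X x) = g Y (F.map f x)) ∧ ∀ i ∈ J.2, g (W i) = s i}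
  -- Each condition involves at most two coordinates of a product of finite discrete spaces, which
  -- is compact by Tychonoff.
  have hZ (J) : IsClosed (Z J) := by
    have h1 (X Y : C) (f : X ⟶ Y) (x : F.obj X) :
        IsClosed {g : ∀ X, Equiv.Perm (F.obj X) | F.map f (g X x) = g Y (F.map f x)} :=
      (isClosed_discrete {a : Equiv.Perm (F.obj X) × Equiv.Perm (F.obj Y) |
        F.map f (a.1 x) = a.2 (F.map f x)}).preimage
        (f := fun g : ∀ X, Equiv.Perm (F.obj X) ↦ (g X, g Y))
        ((continuous_apply X).prodMk (continuous_apply Y))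
    have h2 (i : ι) : IsClosed {g : ∀ X, Equiv.Perm (F.obj X) | g (W i) = s i} :=
      (isClosed_discrete {s i}).preimage (f := fun g : ∀ X, Equiv.Perm (F.obj X) ↦ g (W i))
        (continuous_apply (W i))
    simp only [Z, Set.ofPred_and, Set.ofPred_forall]
    refine .inter ?_ (isClosed_biInter fun i _ ↦ h2 i)
    exact isClosed_biInter fun X _ ↦ isClosed_biInter fun Y _ ↦
      isClosed_iInter fun f ↦ isClosed_iInter fun x ↦ h1 X Y f x
  classical
  obtain ⟨g, hg⟩ := IsCompact.nonempty_iInter_of_directed_nonempty_isCompact_isClosed Z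
    (fun J K ↦ ⟨(J.1 ∪ K.1, J.2 ∪ K.2), fun g hg ↦ ⟨fun X hX Y hY ↦
        hg.1 X (Finset.mem_union_left _ hX) Y (Finset.mem_union_left _ hY),
        fun i hi ↦ hg.2 i (Finset.mem_union_left _ hi)⟩, fun g hg ↦ ⟨fun X hX Y hY ↦
        hg.1 X (Finset.mem_union_right _ hX) Y (Finset.mem_union_right _ hY),
        fun i hi ↦ hg.2 i (Finset.mem_union_right _ hi)⟩⟩)
    (fun J ↦ H J.1 J.2) (fun J ↦ (hZ J).isCompact) hZ
  rw [Set.mem_iInter] at hg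
  refine ⟨NatIso.ofComponents (fun X ↦ FintypeCat.equivEquivIso (g X)) fun {X Y} f ↦ ?_,
    fun i x ↦ ?_⟩
  · ext x
    exact ((hg ({X, Y}, ∅)).1 X (by simp) Y (by simp) f x).symm
  · exact congr($((hg (∅, {i})).2 i (by simp)) x)

variable {F}

/-- If morphisms out of `P` to the objects of `S` are determined by the image of one point, and
all points of these objects are images of `p`, then moving `p` to another point of the fibre
induces permutations of the fibres of these objects. -/
theorem exists_perm_of_dominates (S : Set C) {P : C} (p p' : F.obj P)
    (hrig : ∀ W ∈ S, ∀ (h h' : P ⟶ W) (q : F.obj P), F.map h q = F.map h' q → h = h')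
    (hdom : ∀ W ∈ S, ∀ w : F.obj W, ∃ h : P ⟶ W, F.map h p = w) :
    ∃ g : ∀ W, Equiv.Perm (F.obj W), ∀ W ∈ S, ∀ h : P ⟶ W, g W (F.map h p) = F.map h p' := by
  suffices ∀ W, ∃ g : Equiv.Perm (F.obj W), W ∈ S → ∀ h : P ⟶ W, g (F.map h p) = F.map h p' by
    choose g hg using this
    exact ⟨g, hg⟩
  intro W
  by_cases hW : W ∈ S
  · choose h hh using hdom W hW
    -- If two of these morphisms agree at `p'`, rigidity makes them equal, so they agree at `p`. An
    -- injective self-map of a finite set is bijective; `P` need not be Galois.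
    have hinj : Function.Injective fun w ↦ F.map (h w) p' := fun w w' hw ↦ by
      rw [← hh w, ← hh w', hrig W hW _ _ _ hw]
    refine ⟨Equiv.ofBijective _ (Finite.injective_iff_bijective.mp hinj), fun _ k ↦ ?_⟩
    have : h (F.map k p) = k := hrig W hW _ _ p (hh _)
    simp [this]
  · exact ⟨1, fun h ↦ absurd h hW⟩

end FibreFunctor

/-! ### Connected coverings dominating finitely many others. -/

section FiniteEtale

variable {X : Scheme.{u}}

instance finiteEtale_isStableUnderComposition : finiteEtale.{u}.IsStableUnderComposition where
  comp_mem f g hf hg := by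
    have := hf.1
    have := hf.2
    have := hg.1
    have := hg.2
    exact ⟨inferInstance, inferInstance⟩

instance isFinite_left {P Q : FEt X} (f : P ⟶ Q) : IsFinite f.left := by
  have : IsFinite (f.left ≫ Q.hom) := by rw [MorphismProperty.Over.w f]; infer_instance
  exact .of_comp f.left Q.hom

instance etale_left {P Q : FEt X} (f : P ⟶ Q) : Etale f.left := by
  have : Etale (f.left ≫ Q.hom) := by rw [MorphismProperty.Over.w f]; infer_instance
  exact .of_comp f.left Q.hom

variable {Ω : Type u} [Field Ω] (x : Spec (.of Ω) ⟶ X)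

/-- Fibre products over `X` of the given coverings, starting from `X` itself, carry the tuple of all
the given points. -/
theorem exists_hom_of_finite (s : Set (Σ W : FEt X, Fibre W.hom x)) (hs : s.Finite) :
    ∃ (T : FEt X) (t : Fibre T.hom x), ∀ z ∈ s, ∃ h : T ⟶ z.1, t.1 ≫ h.left = z.2.1 := by
  induction s, hs using Set.Finite.induction_on with
  | empty => exact ⟨.mk ⊤ (𝟙 X) ⟨inferInstance, inferInstance⟩, ⟨x, Category.comp_id _⟩, by simp⟩
  | @insert z s _ _ ih =>
    obtain ⟨T, t, ht⟩ := ih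
    let T' : FEt X := .mk ⊤ (pullback.fst T.hom z.1.hom ≫ T.hom)
      ⟨inferInstance, inferInstance⟩
    let a : T' ⟶ T := MorphismProperty.Over.homMk (pullback.fst T.hom z.1.hom) rfl
    let b : T' ⟶ z.1 :=
      MorphismProperty.Over.homMk (pullback.snd T.hom z.1.hom) pullback.condition.symm
    let l : Spec (.of Ω) ⟶ pullback T.hom z.1.hom :=
      pullback.lift t.1 z.2.1 (t.2.trans z.2.2.symm)
    have hla : l ≫ pullback.fst T.hom z.1.hom = t.1 := pullback.lift_fst _ _ _
    refine ⟨T', ⟨l, by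
      change l ≫ pullback.fst T.hom z.1.hom ≫ T.hom = x
      rw [reassoc_of% hla, t.2]⟩, ?_⟩
    rintro z' (rfl | hz')
    · exact ⟨b, pullback.lift_snd _ _ _⟩
    · obtain ⟨h, hh⟩ := ht z' hz'
      exact ⟨a ≫ h, by
        change l ≫ pullback.fst T.hom z.1.hom ≫ h.left = _
        rw [reassoc_of% hla, hh]⟩

/-- There is a connected finite étale `P ⟶ X` with a point `p` over `x` such that all
points over `x` of the given coverings are images of `p`. -/
theorem exists_connectedSpace_dominates [IsNoetherian X] (S : Set (FEt X)) (hS : S.Finite) :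
    ∃ (P : FEt X) (p : Fibre P.hom x), ConnectedSpace P.left ∧
      ∀ W ∈ S, ∀ w : Fibre W.hom x, ∃ h : P ⟶ W, (fibre x).map h p = w := by
  have := hS.to_subtype
  obtain ⟨T, t, ht⟩ := exists_hom_of_finite x
    (Set.range fun z : Σ W : S, Fibre W.1.hom x ↦ ⟨z.1.1, z.2⟩) (Set.finite_range _)
  have : IsNoetherian T.left :=
    { __ := LocallyOfFiniteType.isLocallyNoetherian (Y := X) T.hom
      __ := QuasiCompact.compactSpace_of_compactSpace (Y := X) T.hom }
  -- Restricting to the connected component of `t` keeps the point and all morphisms out of `T`.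
  obtain ⟨P, i, p, _, _, _, hp⟩ := exists_connectedSpace_fac (T := T.left) t.1
  let P' : FEt X := .mk ⊤ (i ≫ T.hom) ⟨inferInstance, inferInstance⟩
  let j : P' ⟶ T := MorphismProperty.Over.homMk i rfl
  refine ⟨P', ⟨p, by
    change p ≫ i ≫ T.hom = x
    rw [reassoc_of% hp, t.2]⟩, ‹_›, fun W hW w ↦ ?_⟩
  obtain ⟨h, hh⟩ := ht ⟨W, w⟩ ⟨⟨⟨W, hW⟩, w⟩, rfl⟩
  refine ⟨j ≫ h, Subtype.ext ?_⟩
  change p ≫ i ≫ h.left = _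
  rw [reassoc_of% hp, hh]

variable {x}

theorem fibre_map_comp {P Q W : FEt X} (m : P ⟶ Q) (h : Q ⟶ W) (p : (fibre x).obj P) :
    (fibre x).map (m ≫ h) p = (fibre x).map h ((fibre x).map m p) := by
  rw [Functor.map_comp]
  rfl

/-- Morphisms from a connected covering are determined by the image of one geometric point. -/
theorem hom_ext_of_fibre {P W : FEt X} [ConnectedSpace P.left] (h h' : P ⟶ W)
    (q : Fibre P.hom x) (hq : (fibre x).map h q = (fibre x).map h' q) : h = h' := by
  have hq' : q.1 ≫ h.left = q.1 ≫ h'.left := congrArg Subtype.val hq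
  ext
  exact eq_of_comp_eq_of_connectedSpace W.hom h.left h'.left
    ((MorphismProperty.Over.w h).trans (MorphismProperty.Over.w h').symm) q.1 hq'

/-- The fibre functor sends morphisms from a nonempty to a connected covering to surjections. -/
theorem fibre_map_surjective [IsSepClosed Ω] {P Q : FEt X} [Nonempty P.left]
    [ConnectedSpace Q.left] (h : P ⟶ Q) : Function.Surjective ((fibre x).map h) := by
  intro (q : Fibre Q.hom x)
  obtain ⟨p, hp⟩ := exists_fac_of_isFinite_of_etale h.left q.1
  refine ⟨⟨p, ?_⟩, Subtype.ext hp⟩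
  rw [← MorphismProperty.Over.w h, reassoc_of% hp, q.2]

end FiniteEtale

end EtalePi

end

noncomputable section

namespace EtalePi

/-! ### Action on coverings pulled back from the base. -/

section Pullback

variable {T X : Scheme.{u}} (f : T ⟶ X) {Ω : Type u} [Field Ω] (t : Spec (.of Ω) ⟶ T)

/-- The permutation of the fibre of a pulled back covering induced by an element of the
fundamental group of the base. -/
def pullbackPerm (σ : Pi1 (t ≫ f)) (Y : FEt X) :
    Equiv.Perm ((fibre t).obj ((pullbackFEt f).obj Y)) :=
  FintypeCat.equivEquivIso.symm ((fibrePullbackIso f t).app Y ≪≫ Iso.app σ Y ≪≫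
    ((fibrePullbackIso f t).app Y).symm)

theorem pullbackPerm_fst (σ : Pi1 (t ≫ f)) (Y : FEt X) (w : Fibre (pullback.snd Y.hom f) t) :
    fibrePullbackEquiv Y.hom f t (pullbackPerm f t σ Y w) =
      σ.hom.app Y (fibrePullbackEquiv Y.hom f t w) :=
  (fibrePullbackEquiv Y.hom f t).apply_symm_apply _

/-- This turns an equation in the fundamental group of the base into prescribed values on pulled
back coverings, the form needed for the compactness argument. -/
theorem Pi1.map_eq_of_forall (α : Pi1 t) (σ : Pi1 (t ≫ f))
    (h : ∀ Y (w : (fibre t).obj ((pullbackFEt f).obj Y)),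
      α.hom.app _ w = pullbackPerm f t σ Y w) : Pi1.map f t α = σ := by
  ext Y y
  have hy := h Y ((fibrePullbackEquiv Y.hom f t).symm y)
  have h1 : (Pi1.map f t α).hom.app Y y = fibrePullbackEquiv Y.hom f t
      (α.hom.app ((pullbackFEt f).obj Y) ((fibrePullbackEquiv Y.hom f t).symm y)) := rfl
  rw [h1, hy]
  exact (pullbackPerm_fst f t σ Y _).trans
    (congrArg (σ.hom.app Y) ((fibrePullbackEquiv Y.hom f t).apply_symm_apply y))

variable {f t}

/-- If all points of the fibre of `Y` are images of a point `a` of `A`, then all points of the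
fibre of the pullback of `Y` are images of any point above `a`, and `pullbackPerm` is induced by
moving this point to a point above the translate of `a` by `σ`. -/
theorem exists_hom_pullback (σ : Pi1 (t ≫ f)) {A Y : FEt X} (a : Fibre A.hom (t ≫ f))
    (hA : ∀ y : Fibre Y.hom (t ≫ f), ∃ h : A ⟶ Y, (fibre _).map h a = y)
    {Q : FEt T} (c : Q.left ⟶ A.left) (hc : c ≫ A.hom = Q.hom ≫ f)
    (q q' : Fibre Q.hom t) (hq : q.1 ≫ c = a.1) (hq' : q'.1 ≫ c = (σ.hom.app A a).1)
    (w : (fibre t).obj ((pullbackFEt f).obj Y)) :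
    ∃ h : Q ⟶ (pullbackFEt f).obj Y, (fibre t).map h q = w ∧
      (fibre t).map h q' = pullbackPerm f t σ Y w := by
  obtain ⟨h, hh⟩ := hA (fibrePullbackEquiv Y.hom f t w)
  have hh' : a.1 ≫ h.left = w.1 ≫ pullback.fst Y.hom f := congrArg Subtype.val hh
  have hw : h.left ≫ Y.hom = A.hom := MorphismProperty.Over.w h
  have hl : (c ≫ h.left) ≫ Y.hom = Q.hom ≫ f := by rw [Category.assoc, hw, hc]
  let m : Q ⟶ (pullbackFEt f).obj Y :=
    MorphismProperty.Over.homMk (pullback.lift (c ≫ h.left) Q.hom hl) (pullback.lift_snd _ _ _)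
  have hm (r : Fibre Q.hom t) : (fibrePullbackEquiv Y.hom f t ((fibre t).map m r)).1 =
      r.1 ≫ c ≫ h.left := by
    refine (Category.assoc r.1 _ (pullback.fst Y.hom f)).trans (congrArg (r.1 ≫ ·) ?_)
    exact pullback.lift_fst _ _ _
  refine ⟨m, ?_, ?_⟩
  · apply (fibrePullbackEquiv Y.hom f t).injective
    refine Subtype.ext ((hm q).trans ?_)
    rw [reassoc_of% hq, hh']
    rfl
  · apply (fibrePullbackEquiv Y.hom f t).injective
    refine Eq.trans ?_ (pullbackPerm_fst f t σ Y w).symm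
    refine Eq.trans ?_ (congrArg (σ.hom.app Y) hh)
    -- Naturality of `σ` along `h` identifies the image of `σ a` with the `σ`-translate of the image
    -- of `a`.
    refine Eq.trans ?_ (FunctorToFintypeCat.naturality _ _ σ.hom h a).symm
    refine Subtype.ext ((hm q').trans ?_)
    rw [reassoc_of% hq']
    rfl

end Pullback

/-! ### Surjectivity for a product. -/

section Product

variable {k : Type u} [Field k] [IsAlgClosed k] {U V : Scheme.{u}} (f : U ⟶ Spec (.of k))
  (g : V ⟶ Spec (.of k)) [IsNoetherian U] [IsNoetherian V] [IsNoetherian (pullback f g)]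
  [LocallyOfFiniteType f] [LocallyOfFiniteType g]
  {Ω : Type u} [Field Ω] [IsSepClosed Ω] (η : Spec (.of Ω) ⟶ pullback f g)

/-- A pair of elements of the fundamental groups of the factors is realised on finitely many
coverings by permutations that are natural on finitely many coverings of the product. -/
theorem exists_perm_natural (σ : Pi1 (η ≫ pullback.fst f g)) (τ : Pi1 (η ≫ pullback.snd f g))
    (S : Set (FEt (pullback f g))) (hS : S.Finite) (SU : Set (FEt U)) (hSU : SU.Finite)
    (SV : Set (FEt V)) (hSV : SV.Finite) :
    ∃ γ : ∀ W, Equiv.Perm ((fibre η).obj W),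
      (∀ W ∈ S, ∀ W' ∈ S, ∀ (h : W ⟶ W') (w : (fibre η).obj W),
        (fibre η).map h (γ W w) = γ W' ((fibre η).map h w)) ∧
      (∀ Y ∈ SU, γ ((pullbackFEt (pullback.fst f g)).obj Y) = pullbackPerm _ η σ Y) ∧
      (∀ Y ∈ SV, γ ((pullbackFEt (pullback.snd f g)).obj Y) = pullbackPerm _ η τ Y) := by
  obtain ⟨A, a, _, hA⟩ := exists_connectedSpace_dominates (η ≫ pullback.fst f g) SU hSU
  obtain ⟨B, b, _, hB⟩ := exists_connectedSpace_dominates (η ≫ pullback.snd f g) SV hSV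
  let qA : A.left ⟶ U := A.hom
  let qB : B.left ⟶ V := B.hom
  have : IsFinite qA := inferInstanceAs (IsFinite A.hom)
  have : IsFinite qB := inferInstanceAs (IsFinite B.hom)
  -- Connectedness of `A ×_k B` is what lets `σ` and `τ` be chosen independently.
  have hconn : ConnectedSpace ↥(pullback (qA ≫ f) (qB ≫ g)) :=
    connectedSpace_pullback_of_isAlgClosed _ _
  let r : pullback (qA ≫ f) (qB ≫ g) ⟶ pullback f g :=
    pullback.map (qA ≫ f) (qB ≫ g) f g qA qB (𝟙 _) (Category.comp_id _) (Category.comp_id _)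
  have hr : finiteEtale r := MorphismProperty.pullbackMap A.prop B.prop rfl rfl
  have hrA : pullback.fst (qA ≫ f) (qB ≫ g) ≫ qA = r ≫ pullback.fst f g :=
    (pullback.lift_fst _ _ _).symm
  have hrB : pullback.snd (qA ≫ f) (qB ≫ g) ≫ qB = r ≫ pullback.snd f g :=
    (pullback.lift_snd _ _ _).symm
  let Q : FEt (pullback f g) := .mk ⊤ r hr
  have : ConnectedSpace Q.left := hconn
  have hpt (a : Fibre A.hom (η ≫ pullback.fst f g)) (b : Fibre B.hom (η ≫ pullback.snd f g)) :
      ∃ q : Fibre Q.hom η, q.1 ≫ pullback.fst (qA ≫ f) (qB ≫ g) = a.1 ∧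
        q.1 ≫ pullback.snd (qA ≫ f) (qB ≫ g) = b.1 := by
    have ha : a.1 ≫ qA = η ≫ pullback.fst f g := a.2
    have hb : b.1 ≫ qB = η ≫ pullback.snd f g := b.2
    let l : Spec (.of Ω) ⟶ pullback (qA ≫ f) (qB ≫ g) := pullback.lift a.1 b.1 (by
      rw [reassoc_of% ha, reassoc_of% hb, pullback.condition])
    have hlA : l ≫ pullback.fst (qA ≫ f) (qB ≫ g) = a.1 := pullback.lift_fst _ _ _
    have hlB : l ≫ pullback.snd (qA ≫ f) (qB ≫ g) = b.1 := pullback.lift_snd _ _ _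
    refine ⟨⟨l, ?_⟩, hlA, hlB⟩
    change l ≫ r = η
    apply pullback.hom_ext
    · rw [Category.assoc, ← hrA, reassoc_of% hlA, ha]
    · rw [Category.assoc, ← hrB, reassoc_of% hlB, hb]
  obtain ⟨q, hqA, hqB⟩ := hpt a b
  obtain ⟨q', hqA', hqB'⟩ := hpt (σ.hom.app A a) (τ.hom.app B b)
  let S' : Set (FEt (pullback f g)) :=
    S ∪ {Q} ∪ ((pullbackFEt (pullback.fst f g)).obj '' SU ∪
      (pullbackFEt (pullback.snd f g)).obj '' SV)
  obtain ⟨P, p, _, hP⟩ := exists_connectedSpace_dominates η S'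
    ((hS.union (Set.finite_singleton Q)).union ((hSU.image _).union (hSV.image _)))
  obtain ⟨m, hm⟩ := hP Q (.inl (.inr rfl)) q
  -- Since `Q` is connected, the fibre of `P` surjects onto that of `Q`, so some `p'` lies above `q'
  -- = (σ a, τ b)`.
  obtain ⟨p', hp'⟩ := fibre_map_surjective (x := η) m q'
  obtain ⟨γ, hγ⟩ := exists_perm_of_dominates (F := fibre η) S' p p'
    (fun W _ h h' s hs ↦ hom_ext_of_fibre h h' s hs) hP
  -- A permutation induced by moving `q` to `q'` is also induced by moving `p` to `p'`, through `m`.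
  have key {W : FEt (pullback f g)} (hW : W ∈ S') (s : Equiv.Perm ((fibre η).obj W))
      (hs : ∀ w, ∃ h : Q ⟶ W, (fibre η).map h q = w ∧ (fibre η).map h q' = s w) : γ W = s := by
    ext1 w
    obtain ⟨h, h1, h2⟩ := hs w
    have hw : (fibre η).map (m ≫ h) p = w :=
      (fibre_map_comp m h p).trans ((congrArg ((fibre η).map h) hm).trans h1)
    have hw' : (fibre η).map (m ≫ h) p' = s w :=
      (fibre_map_comp m h p').trans ((congrArg ((fibre η).map h) hp').trans h2)
    exact (congrArg (γ W) hw.symm).trans ((hγ W hW (m ≫ h)).trans hw')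
  refine ⟨γ, fun W hW W' hW' h w ↦ ?_, fun Y hY ↦ ?_, fun Y hY ↦ ?_⟩
  -- With `w` the image of `p` under `n`, both sides are the image of `p'` under `n ≫ h`.
  · obtain ⟨n, rfl⟩ := hP W (.inl (.inl hW)) w
    exact (congrArg ((fibre η).map h) (hγ W (.inl (.inl hW)) n)).trans
      ((fibre_map_comp n h p').symm.trans ((hγ W' (.inl (.inl hW')) (n ≫ h)).symm.trans
        (congrArg (γ W') (fibre_map_comp n h p))))
  · exact key (.inr (.inl ⟨Y, hY, rfl⟩)) _
      (exists_hom_pullback σ a (hA Y hY) _ hrA q q' hqA hqA')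
  · exact key (.inr (.inr ⟨Y, hY, rfl⟩)) _
      (exists_hom_pullback τ b (hB Y hY) _ hrB q q' hqB hqB')

/-- The fundamental group of a product of Noetherian schemes locally of finite type over an
algebraically closed field surjects onto the product of the fundamental groups. -/
theorem Pi1.map_prod_surjective :
    Function.Surjective ((Pi1.map (pullback.fst f g) η).prod (Pi1.map (pullback.snd f g) η)) := by
  rintro ⟨σ, τ⟩
  obtain ⟨α, hα⟩ := exists_aut_of_forall_finset (fibre η) (ι := FEt U ⊕ FEt V)
    (Sum.elim (pullbackFEt (pullback.fst f g)).obj (pullbackFEt (pullback.snd f g)).obj)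
    (Sum.rec (pullbackPerm _ η σ) (pullbackPerm _ η τ)) fun S I ↦ by
      obtain ⟨γ, h, hU, hV⟩ := exists_perm_natural f g η σ τ S S.finite_toSet
        (Sum.inl ⁻¹' (I : Set (FEt U ⊕ FEt V))) (I.finite_toSet.preimage Sum.inl_injective.injOn)
        (Sum.inr ⁻¹' (I : Set (FEt U ⊕ FEt V))) (I.finite_toSet.preimage Sum.inr_injective.injOn)
      exact ⟨γ, h, Sum.rec (fun Y hY ↦ hU Y hY) (fun Y hY ↦ hV Y hY)⟩
  exact ⟨α, Prod.ext (map_eq_of_forall _ _ _ _ fun Y w ↦ hα (.inl Y) w)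
    (map_eq_of_forall _ _ _ _ fun Y w ↦ hα (.inr Y) w)⟩

end Product

end EtalePi

end

theorem lemma5p1 {F : Type*} [Field F] [Finite F] {k : Type u} [Field k] [Algebra F k]
    [IsAlgClosure F k] {U V : Scheme.{u}} (f : U ⟶ Spec (.of k)) (g : V ⟶ Spec (.of k))
    [IsAffine U] [IsAffine V] [ConnectedSpace U] [ConnectedSpace V] [Smooth f] [Smooth g]
    {Ω : Type u} [Field Ω] [IsSepClosed Ω] (η : Spec (.of Ω) ⟶ pullback f g) :
    Function.Surjective
      ((EtalePi.Pi1.map (pullback.fst f g) η).prod (EtalePi.Pi1.map (pullback.snd f g) η) :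
        EtalePi.Pi1 η →* EtalePi.Pi1 (η ≫ pullback.fst f g) ×
          EtalePi.Pi1 (η ≫ pullback.snd f g)) := by
  have : IsAlgClosed k := IsAlgClosure.isAlgClosed F
  -- Locally of finite type over a field gives locally Noetherian; affine gives quasi-compact.
  have : IsNoetherian U := { __ := LocallyOfFiniteType.isLocallyNoetherian f }
  have : IsNoetherian V := { __ := LocallyOfFiniteType.isLocallyNoetherian g }
  have : IsNoetherian (pullback f g) := { }
  exact EtalePi.Pi1.map_prod_surjective f g η
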